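/- Let $n\in\mathbb N$, let $\mathbb U^n=(0,1)^n$, and let $\hat f$ be a vector field whose components are real analytic on $\mathbb U^n$ and whose flow $\hat\phi$ on $\mathbb U^n$ is complete: for every $\mathbf u\in\mathbb U^n$ the curve $t\mapsto\hat\phi(\mathbf u,t)$ is defined for all $t\in\mathbb R$, stays in $\mathbb U^n$, and satisfies $\hat\phi(\mathbf u,0)=\mathbf u$ and $\frac{\partial\hat\phi}{\partial t}(\mathbf u,t)=\hat f(\hat\phi(\mathbf u,t))$. Let $R\subseteq\mathbb U^n$ be a hyperrectangle (a product of $n$ intervals). Assume that the closure of $R$ is contained in $\mathbb U^n$ (for example, $R$ is a closed box in $\mathbb U^n$), or else that $\hat f$ is real analytic on a neighbourhood of $[0,1]^n$. For $\tau,t\in\mathbb R$ let $$\Omega(t)=\{\mathbf u\in\mathbb U^n \mid \hat\phi(\mathbf u,\tau-t)\in R\}$$ be the control mass that occupies $R$ at time $\tau$, and let $V_\Omega(t;\tau)$ be the Lebesgue measure of $\Omega(t)$. Let $\Gamma_0(\mathbf u)=1$ and, for $k\ge 1$, $\Gamma_k=\nabla\cdot(\Gamma_{k-1}\hat f)$ on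 $\mathbb U^n$. Then $t\mapsto V_\Omega(t;\tau)$ is infinitely differentiable on $\mathbb R$ and, for all integers $k\ge 0$ and all $t\in\mathbb R$, the function $\Gamma_k$ is integrable over $\Omega(t)$ and $$\frac{d^k}{dt^k}V_\Omega(t;\tau)=\int_{\Omega(t)}\Gamma_k(\mathbf u)\,d\mathbf u .$$ -/

import Mathlib

open MeasureTheory
open scoped ContDiff

/-- The open unit hyperrectangle `(0, 1)^n`. -/
def openCube (n : ℕ) : Set (Fin n → ℝ) :=
  {u | ∀ i, 0 < u i ∧ u i < 1}

/-- The closed unit hyperrectangle `[0, 1]^n`. -/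
def closedCube (n : ℕ) : Set (Fin n → ℝ) :=
  {u | ∀ i, 0 ≤ u i ∧ u i ≤ 1}

/-- A hyperrectangle: a product of real intervals of any kind (open, closed, half-open,
bounded or not). -/
def IsHyperrectangle {n : ℕ} (R : Set (Fin n → ℝ)) : Prop :=
  ∃ I : Fin n → Set ℝ, (∀ i, (I i).OrdConnected) ∧ R = Set.univ.pi I

/-- `φ` is the (complete) flow on `U` of the autonomous vector field `f`: for every initial state
`u ∈ U`, the curve `φ u` is the solution in `U` of `ẋ = f(x)`, `x(0) = u`, for all real times.
Values of `f` and `φ` outside `U` play no role. -/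
structure IsFlowOn {n : ℕ} (f : (Fin n → ℝ) → (Fin n → ℝ))
    (φ : (Fin n → ℝ) → ℝ → (Fin n → ℝ)) (U : Set (Fin n → ℝ)) : Prop where
  map_zero : ∀ u ∈ U, φ u 0 = u
  mapsTo : ∀ u ∈ U, ∀ t : ℝ, φ u t ∈ U
  hasDerivAt : ∀ u ∈ U, ∀ t : ℝ, HasDerivAt (φ u) (f (φ u t)) t

/-- The divergence `∑ i, ∂F_i/∂u_i` of a vector field. -/
noncomputable def divergence {n : ℕ} (F : (Fin n → ℝ) → (Fin n → ℝ)) (u : Fin n → ℝ) : ℝ :=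
  ∑ i, fderiv ℝ (fun v => F v i) u (Pi.single i 1)

/-- `Γ_0 = 1` and `Γ_k = ∇ · (Γ_{k-1} f)`. -/
noncomputable def Gam {n : ℕ} (f : (Fin n → ℝ) → (Fin n → ℝ)) : ℕ → (Fin n → ℝ) → ℝ
  | 0 => fun _ => 1
  | k + 1 => divergence (fun u => Gam f k u • f u)

/-- The control mass `Ω(t)`: the states in the unit hyperrectangle that the flow brings into `R`
after the time `τ - t`. -/
def controlMass {n : ℕ} (φ : (Fin n → ℝ) → ℝ → (Fin n → ℝ)) (R : Set (Fin n → ℝ))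
    (τ t : ℝ) : Set (Fin n → ℝ) :=
  {u | u ∈ openCube n ∧ φ u (τ - t) ∈ R}

/-- The volume function `V(t; τ)`, the Lebesgue measure of `Ω(t)` (at most one). -/
noncomputable def volumeFunction {n : ℕ} (φ : (Fin n → ℝ) → ℝ → (Fin n → ℝ))
    (R : Set (Fin n → ℝ)) (τ t : ℝ) : ℝ :=
  volume.real (controlMass φ R τ t)

/-! This is the Reynolds transport theorem, iterated. The group law gives `Ω(t + h) = φ_h(Ω(t))`, so
a change of variables turns the integral of `g` over `Ω(t + h)` into that of `|det Dφ_h| · g ∘ φ_h`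
over `Ω(t)`. This integrand is `g + h ∇·(g f) + o(h)`, uniformly on a neighbourhood `W` of `Ω(t)`.
Hence the derivative is the integral of `∇·(g f)`. Taking `g = Γ_k` and starting from `Γ_0 = 1`
yields every derivative of the volume.

Differentiability of the flow in the initial state is never proved. Grönwall makes `φ_h` Lipschitz
on `W`, so it is differentiable almost everywhere (Rademacher), and the exceptional set and its
image are null. Where `Dφ_h` exists, it is `1 + h Df + O(h²)`, because `u ↦ φ_h u - u - h f(u)` has
Lipschitz constant `O(h²)`.

Uniformity comes from a compact convex `K`, inside the open set where `f` is analytic, that contains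
all trajectories from `W` for `|h| ≤ 1` (`exists_nhds_controlMass`). Both alternatives of the
regularity assumption supply one. -/

/-! ### Grönwall estimates and the group law of the flow -/

open Set in
-- Grönwall on `[0, 1]` for `r ↦ γ (r * t)`, which solves the equation with field `t • f`; this
-- treats both signs of `t` at once. Leaving out `r = 1` permits its use up to a first exit time.
theorem dist_le_exp_of_trajectories {E : Type*} [NormedAddCommGroup E] [NormedSpace ℝ E]
    {f : E → E} {K : Set E} {L : NNReal} (hf : LipschitzOnWith L f K) {γ₁ γ₂ : ℝ → E}
    (h₁ : ∀ s, HasDerivAt γ₁ (f (γ₁ s)) s) (h₂ : ∀ s, HasDerivAt γ₂ (f (γ₂ s)) s) {t : ℝ}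
    (hK₁ : ∀ r ∈ Ico (0 : ℝ) 1, γ₁ (r * t) ∈ K) (hK₂ : ∀ r ∈ Ico (0 : ℝ) 1, γ₂ (r * t) ∈ K) :
    dist (γ₁ t) (γ₂ t) ≤ dist (γ₁ 0) (γ₂ 0) * Real.exp (L * |t|) := by
  have hder : ∀ γ : ℝ → E, (∀ s, HasDerivAt γ (f (γ s)) s) → ∀ r : ℝ,
      HasDerivAt (fun r => γ (r * t)) (t • f (γ (r * t))) r := fun γ h r =>
    HasDerivAt.scomp r (h (r * t)) (by simpa using (hasDerivAt_id r).mul_const t)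
  have hL : LipschitzOnWith (L * ‖t‖₊) (fun x => t • f x) K := by
    refine LipschitzOnWith.of_dist_le_mul fun x hx y hy => ?_
    rw [dist_smul₀]
    have := hf.dist_le_mul x hx y hy
    push_cast
    calc ‖t‖ * dist (f x) (f y) ≤ ‖t‖ * (L * dist x y) := by gcongr
      _ = _ := by ring
  have := dist_le_of_trajectories_ODE_of_mem (a := 0) (b := 1) (v := fun _ x => t • f x)
    (s := fun _ => K) (fun _ _ => hL)
    (fun r _ => (hder γ₁ h₁ r).continuousAt.continuousWithinAt)
    (fun r _ => (hder γ₁ h₁ r).hasDerivWithinAt) hK₁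
    (fun r _ => (hder γ₂ h₂ r).continuousAt.continuousWithinAt)
    (fun r _ => (hder γ₂ h₂ r).hasDerivWithinAt) hK₂ le_rfl 1 (by simp)
  simpa using this

open Metric Pointwise in
-- The closed convex hull works: `conv C + ball = conv (C + ball)` stays in the convex set `U` when
-- the ball is small. Convexity is what turns `C¹` into Lipschitz on `K`.
theorem IsCompact.exists_convex_subset_of_isOpen {E : Type*} [NormedAddCommGroup E]
    [NormedSpace ℝ E] [FiniteDimensional ℝ E] {C U : Set E} (hC : IsCompact C) (hU : IsOpen U)
    (hUc : Convex ℝ U) (hCU : C ⊆ U) :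
    ∃ K, IsCompact K ∧ Convex ℝ K ∧ C ⊆ K ∧ K ⊆ U := by
  have : ProperSpace E := FiniteDimensional.proper ℝ E
  obtain ⟨δ, hδ, hδU⟩ := hC.exists_cthickening_subset_open hU hCU
  refine ⟨closure (convexHull ℝ C), ?_, (convex_convexHull ℝ C).closure,
    (subset_convexHull ℝ C).trans subset_closure, ?_⟩
  · exact (isBounded_convexHull.2 hC.isBounded).isCompact_closure
  · refine (closure_subset_thickening hδ _).trans ?_
    rw [← add_ball_zero, ← (convex_ball (0 : E) δ).convexHull_eq, ← convexHull_add, add_ball_zero]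
    exact convexHull_min ((thickening_subset_cthickening δ C).trans hδU) hUc

namespace IsFlowOn

variable {n : ℕ} {f : (Fin n → ℝ) → (Fin n → ℝ)} {φ : (Fin n → ℝ) → ℝ → (Fin n → ℝ)}
  {U : Set (Fin n → ℝ)}

theorem continuous (hφ : IsFlowOn f φ U) {u : Fin n → ℝ} (hu : u ∈ U) : Continuous (φ u) :=
  continuous_iff_continuousAt.2 fun t => (hφ.hasDerivAt u hu t).continuousAt

open Set Metric in
/-- Trajectories starting close to a given one stay close to it on a bounded time interval. -/
theorem exists_dist_lt (hφ : IsFlowOn f φ U) (hU : IsOpen U) (hUc : Convex ℝ U)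
    (hf : ContDiffOn ℝ 1 f U) {u : Fin n → ℝ} (hu : u ∈ U) (T : ℝ) {ε : ℝ} (hε : 0 < ε) :
    ∃ δ > 0, ∀ v ∈ U, dist v u < δ → ∀ t, |t| ≤ T → dist (φ v t) (φ u t) < ε := by
  have hΓ : IsCompact (φ u '' Icc (-T) T) := isCompact_Icc.image (hφ.continuous hu)
  have hΓU : φ u '' Icc (-T) T ⊆ U := by
    rintro _ ⟨t, -, rfl⟩; exact hφ.mapsTo u hu t
  obtain ⟨η, hη, hηU⟩ := hΓ.exists_cthickening_subset_open hU hΓU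
  obtain ⟨K, hK, hKc, hKη, hKU⟩ :=
    hΓ.cthickening.exists_convex_subset_of_isOpen hU hUc hηU
  obtain ⟨L, hL⟩ := (hf.mono hKU).exists_lipschitzOnWith one_ne_zero hKc hK
  set ρ := min ε η
  have hρ : 0 < ρ := lt_min hε hη
  -- The radius is such that Grönwall growth up to time `T` keeps the distance below `ρ`.
  refine ⟨ρ * Real.exp (-(L * T)), by positivity, fun v hv hvu t ht => ?_⟩
  refine lt_of_lt_of_le ?_ (min_le_left ε η)
  by_contra hcon
  rw [not_lt] at hcon
  set g : ℝ → ℝ := fun r => dist (φ v (r * t)) (φ u (r * t))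
  have hgc : Continuous g :=
    ((hφ.continuous hv).comp (by fun_prop)).dist ((hφ.continuous hu).comp (by fun_prop))
  have hT : 0 ≤ T := (abs_nonneg t).trans ht
  set S := Icc (0 : ℝ) 1 ∩ g ⁻¹' Ici ρ
  have hS : IsCompact S := isCompact_Icc.inter_right (isClosed_Ici.preimage hgc)
  have hS1 : (1 : ℝ) ∈ S := ⟨by simp, by
    change ρ ≤ dist (φ v (1 * t)) (φ u (1 * t))
    rwa [one_mul]⟩
  -- `r * t` is the first time at which the distance reaches `ρ`. Before it both trajectories lie in
  -- `K`, so Grönwall applies and contradicts the distance being `ρ` there.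
  obtain ⟨r, hr, hmin⟩ := hS.exists_isLeast ⟨1, hS1⟩
  have hlt : ∀ q ∈ Ico (0 : ℝ) 1, g (q * r) < ρ := by
    intro q hq
    by_contra! h
    have hr0 : r ≠ 0 := by
      rintro rfl
      have : ρ ≤ dist v u := by
        simpa [g, hφ.map_zero v hv, hφ.map_zero u hu] using hr.2
      have : Real.exp (-(L * T)) ≤ 1 := Real.exp_le_one_iff.2 (by simp; positivity)
      nlinarith
    have hr0' : 0 < r := lt_of_le_of_ne hr.1.1 (Ne.symm hr0)
    have : r ≤ q * r := hmin ⟨⟨mul_nonneg hq.1 hr0'.le, by nlinarith [hq.2, hr.1.2]⟩, h⟩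
    nlinarith [hq.2]
  have hmem : ∀ q ∈ Ico (0 : ℝ) 1, φ u (q * (r * t)) ∈ φ u '' Icc (-T) T := by
    intro q hq
    refine ⟨_, abs_le.1 ?_, rfl⟩
    rw [abs_mul, abs_mul, abs_of_nonneg hq.1, abs_of_nonneg hr.1.1]
    have : r * |t| ≤ |t| := mul_le_of_le_one_left (abs_nonneg t) hr.1.2
    have : q * (r * |t|) ≤ r * |t| :=
      mul_le_of_le_one_left (mul_nonneg hr.1.1 (abs_nonneg t)) hq.2.le
    linarith
  have hd := dist_le_exp_of_trajectories hL (hφ.hasDerivAt v hv) (hφ.hasDerivAt u hu) (t := r * t)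
    (fun q hq => hKη (mem_cthickening_of_dist_le _ _ _ _ (hmem q hq)
      (by have := hlt q hq
          simp only [g, mul_assoc] at this
          exact this.le.trans (min_le_right _ _))))
    (fun q hq => hKη (self_subset_cthickening _ (hmem q hq)))
  rw [hφ.map_zero v hv, hφ.map_zero u hu] at hd
  have h1 : ρ ≤ dist (φ v (r * t)) (φ u (r * t)) := hr.2
  have h2 : Real.exp (L * |r * t|) ≤ Real.exp (L * T) := by
    rw [abs_mul, abs_of_nonneg hr.1.1]
    have : r * |t| ≤ T := (mul_le_of_le_one_left (abs_nonneg t) hr.1.2).trans ht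
    gcongr
  have h3 : dist v u * Real.exp (L * T) < ρ := by
    rwa [Real.exp_neg, ← div_eq_mul_inv, lt_div_iff₀ (Real.exp_pos _)] at hvu
  have h4 : dist v u * Real.exp (L * |r * t|) ≤ dist v u * Real.exp (L * T) := by gcongr
  linarith

theorem continuousOn (hφ : IsFlowOn f φ U) (hU : IsOpen U) (hUc : Convex ℝ U)
    (hf : ContDiffOn ℝ 1 f U) (t : ℝ) : ContinuousOn (fun u => φ u t) U := by
  intro u hu
  rw [Metric.continuousWithinAt_iff]
  intro ε hε
  obtain ⟨δ, hδ, h⟩ := hφ.exists_dist_lt hU hUc hf hu |t| hε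
  exact ⟨δ, hδ, fun v hv hvu => h v hv hvu t le_rfl⟩

open Set Metric in
/-- The trajectories starting in a compact set remain in a compact set for a bounded time. -/
theorem exists_isCompact (hφ : IsFlowOn f φ U) (hU : IsOpen U) (hUc : Convex ℝ U)
    (hf : ContDiffOn ℝ 1 f U) {C : Set (Fin n → ℝ)} (hC : IsCompact C) (hCU : C ⊆ U) (T : ℝ) :
    ∃ K, IsCompact K ∧ Convex ℝ K ∧ K ⊆ U ∧ ∀ u ∈ C, ∀ t, |t| ≤ T → φ u t ∈ K := by
  suffices h : ∃ K, IsCompact K ∧ K ⊆ U ∧ ∀ u ∈ C, ∀ t, |t| ≤ T → φ u t ∈ K by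
    obtain ⟨K, hK, hKU, h⟩ := h
    obtain ⟨K', hK', hKc, hKK, hKU'⟩ := hK.exists_convex_subset_of_isOpen hU hUc hKU
    exact ⟨K', hK', hKc, hKU', fun u hu t ht => hKK (h u hu t ht)⟩
  refine hC.induction_on (p := fun S => ∃ K, IsCompact K ∧ K ⊆ U ∧
    ∀ u ∈ S, ∀ t, |t| ≤ T → φ u t ∈ K) ⟨∅, by simp⟩ ?_ ?_ ?_
  · rintro s t hst ⟨K, hK, hKU, h⟩
    exact ⟨K, hK, hKU, fun u hu => h u (hst hu)⟩
  · rintro s t ⟨K, hK, hKU, h⟩ ⟨K', hK', hKU', h'⟩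
    refine ⟨K ∪ K', hK.union hK', union_subset hKU hKU', ?_⟩
    rintro u (hu | hu) t ht
    · exact Or.inl (h u hu t ht)
    · exact Or.inr (h' u hu t ht)
  · intro u huC
    have hu := hCU huC
    have hΓ : IsCompact (φ u '' Icc (-T) T) := isCompact_Icc.image (hφ.continuous hu)
    have hΓU : φ u '' Icc (-T) T ⊆ U := by
      rintro _ ⟨t, -, rfl⟩; exact hφ.mapsTo u hu t
    obtain ⟨η, hη, hηU⟩ := hΓ.exists_cthickening_subset_open hU hΓU
    obtain ⟨δ, hδ, h⟩ := hφ.exists_dist_lt hU hUc hf hu T hη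
    refine ⟨C ∩ ball u δ, inter_mem_nhdsWithin C (ball_mem_nhds u hδ), _, hΓ.cthickening, hηU, ?_⟩
    intro v hv t ht
    exact mem_cthickening_of_dist_le _ _ _ _ ⟨t, abs_le.1 ht, rfl⟩ (h v (hCU hv.1) hv.2 t ht).le

open Set in
-- Both sides solve the same equation in `t` from the same point; Grönwall with initial distance
-- zero, on a compact convex set containing both arcs, gives uniqueness.
theorem map_add (hφ : IsFlowOn f φ U) (hU : IsOpen U) (hUc : Convex ℝ U)
    (hf : ContDiffOn ℝ 1 f U) {u : Fin n → ℝ} (hu : u ∈ U) (s t : ℝ) :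
    φ u (s + t) = φ (φ u s) t := by
  have hv := hφ.mapsTo u hu s
  set v := φ u s with hv_def
  set γ : ℝ → (Fin n → ℝ) := fun t => φ u (s + t) with hγ
  have hγd : ∀ t, HasDerivAt γ (f (γ t)) t := fun t =>
    HasDerivAt.comp_const_add s t (hφ.hasDerivAt u hu (s + t))
  have hγc : Continuous γ := (hφ.continuous hu).comp (by fun_prop)
  have hm : Continuous fun r : ℝ => r * t := by fun_prop
  obtain ⟨K, hK, hKc, hsub, hKU⟩ := IsCompact.exists_convex_subset_of_isOpen
    ((isCompact_Icc (a := (0 : ℝ)) (b := 1)).image (hγc.comp hm) |>.union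
      ((isCompact_Icc (a := (0 : ℝ)) (b := 1)).image ((hφ.continuous hv).comp hm))) hU hUc (by
        rintro _ (⟨r, -, rfl⟩ | ⟨r, -, rfl⟩)
        · exact hφ.mapsTo u hu _
        · exact hφ.mapsTo v hv _)
  obtain ⟨L, hL⟩ := (hf.mono hKU).exists_lipschitzOnWith one_ne_zero hKc hK
  have := dist_le_exp_of_trajectories hL hγd (hφ.hasDerivAt v hv) (t := t)
    (fun r hr => hsub (Or.inl ⟨r, Ico_subset_Icc_self hr, rfl⟩))
    (fun r hr => hsub (Or.inr ⟨r, Ico_subset_Icc_self hr, rfl⟩))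
  rw [hφ.map_zero v hv, show γ 0 = v by simp [hγ, hv_def], dist_self, zero_mul] at this
  exact dist_le_zero.1 this

theorem map_map_neg (hφ : IsFlowOn f φ U) (hU : IsOpen U) (hUc : Convex ℝ U)
    (hf : ContDiffOn ℝ 1 f U) {u : Fin n → ℝ} (hu : u ∈ U) (t : ℝ) : φ (φ u (-t)) t = u := by
  rw [← hφ.map_add hU hUc hf hu, neg_add_cancel, hφ.map_zero u hu]

theorem injOn (hφ : IsFlowOn f φ U) (hU : IsOpen U) (hUc : Convex ℝ U)
    (hf : ContDiffOn ℝ 1 f U) (t : ℝ) : Set.InjOn (fun u => φ u t) U := by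
  intro u hu v hv h
  have := congrArg (fun w => φ w (-t)) h
  simpa [← hφ.map_add hU hUc hf hu, ← hφ.map_add hU hUc hf hv, hφ.map_zero u hu,
    hφ.map_zero v hv] using this

end IsFlowOn

/-! ### First-order determinant, Taylor bounds and the product rule -/

open Asymptotics Topology in
/-- The first-order expansion `det (1 + M) = 1 + tr M + o(M)`. -/
theorem ContinuousLinearMap.det_one_add_isLittleO {n : ℕ} :
    (fun M : (Fin n → ℝ) →L[ℝ] (Fin n → ℝ) => (1 + M).det - 1 - ∑ i, M (Pi.single i 1) i)
      =o[𝓝 0] fun M => M := by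
  have hdet : ∀ M : (Fin n → ℝ) →L[ℝ] (Fin n → ℝ),
      (1 + M).det = (1 + LinearMap.toMatrix' (M : (Fin n → ℝ) →ₗ[ℝ] (Fin n → ℝ))).det := by
    intro M
    rw [ContinuousLinearMap.det, ← LinearMap.det_toMatrix']
    congr 1
    rw [ContinuousLinearMap.toLinearMap_add, map_add]
    congr 1
    exact LinearMap.toMatrix'_one
  have hdiff : DifferentiableAt ℝ
      (fun M : (Fin n → ℝ) →L[ℝ] (Fin n → ℝ) => (1 + M).det) 0 := by
    simp only [hdet, Matrix.det_apply, Matrix.add_apply, LinearMap.toMatrix'_apply,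
      ContinuousLinearMap.coe_coe]
    fun_prop
  -- The derivative at `0` is identified along lines, where `det (1 + r M)` is `1 + r tr M` plus
  -- `r²` times a polynomial in `r`.
  have hF : ∀ M : (Fin n → ℝ) →L[ℝ] (Fin n → ℝ),
      fderiv ℝ (fun M : (Fin n → ℝ) →L[ℝ] (Fin n → ℝ) => (1 + M).det) 0 M =
        ∑ i, M (Pi.single i 1) i := by
    intro M
    have h1 : HasDerivAt (fun r : ℝ => (1 + r • M).det)
        (fderiv ℝ (fun M : (Fin n → ℝ) →L[ℝ] (Fin n → ℝ) => (1 + M).det) 0 M) 0 := by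
      have hl : HasDerivAt (fun r : ℝ => r • M) M 0 := by
        simpa using (hasDerivAt_id (0 : ℝ)).smul_const M
      have hd : HasFDerivAt (fun M : (Fin n → ℝ) →L[ℝ] (Fin n → ℝ) => (1 + M).det)
          (fderiv ℝ (fun M : (Fin n → ℝ) →L[ℝ] (Fin n → ℝ) => (1 + M).det) 0) ((0 : ℝ) • M) := by
        simpa using hdiff.hasFDerivAt
      exact hd.comp_hasDerivAt (0 : ℝ) hl
    have h2 : HasDerivAt (fun r : ℝ => (1 + r • M).det) (∑ i, M (Pi.single i 1) i) 0 := by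
      have : ∀ r : ℝ, (1 + r • M).det = _ := fun r => by
        rw [hdet, ContinuousLinearMap.toLinearMap_smul, map_smul, Matrix.det_one_add_smul]
      simp only [this]
      convert! ((((hasDerivAt_id (0 : ℝ)).const_mul _).const_add 1).add
        ((Polynomial.hasDerivAt _ (0 : ℝ)).mul ((hasDerivAt_id (0 : ℝ)).pow 2))) using 1
      simp [Matrix.trace, LinearMap.toMatrix'_apply]
    exact h1.unique h2
  have := hdiff.hasFDerivAt.isLittleO
  simp only [hF, sub_zero, add_zero] at this
  convert! this using 3
  simp [ContinuousLinearMap.det]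

theorem abs_sum_apply_single_le {n : ℕ} (M : (Fin n → ℝ) →L[ℝ] (Fin n → ℝ)) :
    |∑ i, M (Pi.single i 1) i| ≤ n * ‖M‖ := by
  refine (Finset.abs_sum_le_sum_abs _ _).trans ?_
  have : ∀ i ∈ Finset.univ, |M (Pi.single i 1) i| ≤ ‖M‖ := fun i _ => by
    refine (norm_le_pi_norm (M (Pi.single i 1)) i).trans ((M.le_opNorm _).trans ?_)
    simp [Pi.norm_single]
  simpa using Finset.sum_le_sum this

section MeanValue

variable {F : Type*} [NormedAddCommGroup F] [NormedSpace ℝ F]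

theorem norm_sub_zero_le_of_norm_deriv_le {γ γ' : ℝ → F} {h B : ℝ}
    (hd : ∀ s, |s| ≤ |h| → HasDerivAt γ (γ' s) s) (hb : ∀ s, |s| ≤ |h| → ‖γ' s‖ ≤ B) :
    ‖γ h - γ 0‖ ≤ B * |h| := by
  have := (convex_Icc (-|h|) |h|).norm_image_sub_le_of_norm_hasDerivWithin_le
    (f := γ) (f' := γ') (fun s hs => (hd s (abs_le.2 hs)).hasDerivWithinAt)
    (fun s hs => hb s (abs_le.2 hs)) (x := 0) (y := h) ⟨by simp, by simp⟩ (abs_le.1 le_rfl)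
  simpa using this

/-- The mean value inequality applied twice, which costs the factor `1/2` of the sharp constant. -/
theorem norm_taylor_two_le {γ γ' γ'' : ℝ → F} {h B : ℝ}
    (hd : ∀ s, |s| ≤ |h| → HasDerivAt γ (γ' s) s)
    (hd' : ∀ s, |s| ≤ |h| → HasDerivAt γ' (γ'' s) s) (hb : ∀ s, |s| ≤ |h| → ‖γ'' s‖ ≤ B) :
    ‖γ h - γ 0 - h • γ' 0‖ ≤ B * h ^ 2 := by
  have hB : 0 ≤ B := (norm_nonneg _).trans (hb 0 (by simp))
  have h1 : ∀ s, |s| ≤ |h| → ‖γ' s - γ' 0‖ ≤ B * |h| := fun s hs =>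
    (norm_sub_zero_le_of_norm_deriv_le (fun r hr => hd' r (hr.trans hs))
      (fun r hr => hb r (hr.trans hs))).trans (by gcongr)
  have := norm_sub_zero_le_of_norm_deriv_le (γ := fun s => γ s - s • γ' 0)
    (γ' := fun s => γ' s - γ' 0) (h := h)
    (fun s hs => by simpa using (hd s hs).fun_sub ((hasDerivAt_id' s).smul_const (γ' 0))) h1
  rw [mul_assoc, abs_mul_abs_self] at this
  simpa [sub_right_comm, pow_two] using this

end MeanValue

theorem ContDiffOn.fderiv_apply_self {E F : Type*} [NormedAddCommGroup E] [NormedSpace ℝ E]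
    [NormedAddCommGroup F] [NormedSpace ℝ F] {f : E → E} {D : Set E} {H : E → F} (hD : IsOpen D)
    (hf : ContDiffOn ℝ ∞ f D) (hH : ContDiffOn ℝ ∞ H D) :
    ContDiffOn ℝ ∞ (fun x => fderiv ℝ H x (f x)) D :=
  (hH.fderiv_of_isOpen hD (by simp)).clm_apply hf

theorem divergence_eq_sum {n : ℕ} {F : (Fin n → ℝ) → (Fin n → ℝ)} {u : Fin n → ℝ}
    (hF : DifferentiableAt ℝ F u) :
    divergence F u = ∑ i, fderiv ℝ F u (Pi.single i 1) i := by
  refine Finset.sum_congr rfl fun i _ => ?_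
  rw [fderiv_apply hF]
  rfl

theorem divergence_smul {n : ℕ} {g : (Fin n → ℝ) → ℝ} {F : (Fin n → ℝ) → (Fin n → ℝ)}
    {u : Fin n → ℝ} (hg : DifferentiableAt ℝ g u) (hF : DifferentiableAt ℝ F u) :
    divergence (fun v => g v • F v) u =
      fderiv ℝ g u (F u) + g u * ∑ i, fderiv ℝ F u (Pi.single i 1) i := by
  rw [divergence_eq_sum (hg.fun_smul hF), fderiv_fun_smul hg hF]
  have : fderiv ℝ g u (F u) = ∑ i, F u i * fderiv ℝ g u (Pi.single i 1) := by
    conv_lhs => rw [pi_eq_sum_univ' (F u)]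
    simp [map_sum]
  rw [this, Finset.mul_sum, ← Finset.sum_add_distrib]
  refine Finset.sum_congr rfl fun i _ => ?_
  simp
  ring

/-! ### Uniform expansion of the transported density -/

namespace IsFlowOn

variable {n : ℕ} {f : (Fin n → ℝ) → (Fin n → ℝ)} {φ : (Fin n → ℝ) → ℝ → (Fin n → ℝ)}
  {U D K W : Set (Fin n → ℝ)}

theorem hasDerivAt_comp {F : Type*} [NormedAddCommGroup F] [NormedSpace ℝ F]
    (hφ : IsFlowOn f φ U) (hD : IsOpen D) {H : (Fin n → ℝ) → F} (hH : ContDiffOn ℝ ∞ H D)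
    {u : Fin n → ℝ} (hu : u ∈ U) {t : ℝ} (ht : φ u t ∈ D) :
    HasDerivAt (fun s => H (φ u s)) (fderiv ℝ H (φ u t) (f (φ u t))) t :=
  HasFDerivAt.comp_hasDerivAt t (f := φ u) (((hH.differentiableOn (by simp)).differentiableAt
    (hD.mem_nhds ht)).hasFDerivAt) (hφ.hasDerivAt u hu t)

theorem exists_lipschitzOnWith (hφ : IsFlowOn f φ U) (hf : ContDiffOn ℝ ∞ f D)
    (hK : IsCompact K) (hKc : Convex ℝ K) (hKD : K ⊆ D) (hWU : W ⊆ U)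
    (hWK : ∀ u ∈ W, ∀ h, |h| ≤ 1 → φ u h ∈ K) :
    ∃ C, ∀ h, |h| ≤ 1 → LipschitzOnWith C (fun u => φ u h) W := by
  obtain ⟨L, hL⟩ := (hf.mono hKD).exists_lipschitzOnWith (by simp) hKc hK
  refine ⟨(Real.exp L).toNNReal, fun h hh => LipschitzOnWith.of_dist_le_mul fun u hu v hv => ?_⟩
  have hr : ∀ r ∈ Set.Ico (0 : ℝ) 1, |r * h| ≤ 1 := fun r hr => by
    rw [abs_mul, abs_of_nonneg hr.1]
    exact mul_le_one₀ hr.2.le (abs_nonneg h) hh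
  have := dist_le_exp_of_trajectories hL (hφ.hasDerivAt u (hWU hu)) (hφ.hasDerivAt v (hWU hv))
    (t := h) (fun r h => hWK u hu _ (hr r h)) (fun r h => hWK v hv _ (hr r h))
  rw [hφ.map_zero u (hWU hu), hφ.map_zero v (hWU hv)] at this
  rw [Real.coe_toNNReal _ (Real.exp_pos _).le, mul_comm]
  refine this.trans ?_
  have : (L : ℝ) * |h| ≤ L := mul_le_of_le_one_right L.2 hh
  gcongr

/-- The map `u ↦ φ u h - u - h f(u)` is Lipschitz with constant `O(h ^ 2)`. -/
theorem exists_lipschitzOnWith_sub (hφ : IsFlowOn f φ U) (hD : IsOpen D)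
    (hf : ContDiffOn ℝ ∞ f D) (hK : IsCompact K) (hKc : Convex ℝ K) (hKD : K ⊆ D) (hWU : W ⊆ U)
    (hWK : ∀ u ∈ W, ∀ h, |h| ≤ 1 → φ u h ∈ K) :
    ∃ C : NNReal, ∀ h, |h| ≤ 1 →
      LipschitzOnWith (C * ‖h‖₊ ^ 2) (fun u => φ u h - u - h • f u) W := by
  obtain ⟨C, hC⟩ := hφ.exists_lipschitzOnWith hf hK hKc hKD hWU hWK
  have hG := hf.fderiv_apply_self hD hf
  obtain ⟨L, hL⟩ := (hG.mono hKD).exists_lipschitzOnWith (by simp) hKc hK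
  refine ⟨L * C, fun h hh => LipschitzOnWith.of_dist_le_mul fun u hu v hv => ?_⟩
  have hm : ∀ w ∈ W, ∀ s, |s| ≤ |h| → φ w s ∈ K := fun w hw s hs => hWK w hw s (hs.trans hh)
  -- A trajectory has second derivative `G = Df · f` along itself. Since `G` is Lipschitz on `K` and
  -- the flow is Lipschitz on `W`, the second derivative of the difference is at most `L C dist u
  -- v`.
  have := norm_taylor_two_le (h := h) (γ := fun s => φ u s - φ v s)
    (γ' := fun s => f (φ u s) - f (φ v s)) (B := L * (C * dist u v))
    (fun s _ => (hφ.hasDerivAt u (hWU hu) s).fun_sub (hφ.hasDerivAt v (hWU hv) s))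
    (fun s hs => (hφ.hasDerivAt_comp hD hf (hWU hu) (hKD (hm u hu s hs))).fun_sub
      (hφ.hasDerivAt_comp hD hf (hWU hv) (hKD (hm v hv s hs))))
    (fun s hs => by
      rw [← dist_eq_norm]
      refine (hL.dist_le_mul _ (hm u hu s hs) _ (hm v hv s hs)).trans ?_
      gcongr
      exact (hC s (hs.trans hh)).dist_le_mul u hu v hv)
  simp only [hφ.map_zero u (hWU hu), hφ.map_zero v (hWU hv)] at this
  rw [dist_eq_norm]
  calc ‖φ u h - u - h • f u - (φ v h - v - h • f v)‖
      = ‖φ u h - φ v h - (u - v) - h • (f u - f v)‖ := by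
        congr 1; rw [smul_sub]; abel
    _ ≤ _ := this
    _ = _ := by push_cast; rw [Real.norm_eq_abs, sq_abs]; ring

/-- First-order expansion of the density `g (φ_h u) |det Dφ_h u|`, uniformly in `u ∈ W`. -/
theorem eventually_abs_det_fderiv_mul_sub_le (hφ : IsFlowOn f φ U) (hD : IsOpen D)
    (hf : ContDiffOn ℝ ∞ f D) (hK : IsCompact K) (hKc : Convex ℝ K) (hKD : K ⊆ D)
    (hW : IsOpen W) (hWU : W ⊆ U) (hWK : ∀ u ∈ W, ∀ h, |h| ≤ 1 → φ u h ∈ K)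
    {g : (Fin n → ℝ) → ℝ} (hg : ContDiffOn ℝ ∞ g D) {η : ℝ} (hη : 0 < η) :
    ∀ᶠ h in nhds (0 : ℝ), ∀ u ∈ W, DifferentiableAt ℝ (fun v => φ v h) u →
      ‖|(fderiv ℝ (fun v => φ v h) u).det| * g (φ u h) - g u
        - h * divergence (fun v => g v • f v) u‖ ≤ η * |h| := by
  have hWK0 : W ⊆ K := fun u hu => by simpa [hφ.map_zero u (hWU hu)] using hWK u hu 0 (by simp)
  obtain ⟨C, hC⟩ := hφ.exists_lipschitzOnWith_sub hD hf hK hKc hKD hWU hWK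
  have hgf := hf.fderiv_apply_self hD hg
  obtain ⟨M₀, hM₀⟩ := hK.exists_bound_of_continuousOn (hg.continuousOn.mono hKD)
  obtain ⟨M₁, hM₁⟩ := hK.exists_bound_of_continuousOn (hgf.continuousOn.mono hKD)
  obtain ⟨M₂, hM₂⟩ := hK.exists_bound_of_continuousOn
    ((hf.fderiv_apply_self hD hgf).continuousOn.mono hKD)
  obtain ⟨B, hB⟩ := hK.exists_bound_of_continuousOn
    ((hf.fderiv_of_isOpen (m := ∞) hD (by simp)).continuousOn.mono hKD)
  rcases W.eq_empty_or_nonempty with rfl | ⟨w, hw⟩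
  · simp
  have hM₀0 : 0 ≤ M₀ := (norm_nonneg _).trans (hM₀ w (hWK0 hw))
  have hM₁0 : 0 ≤ M₁ := (norm_nonneg _).trans (hM₁ w (hWK0 hw))
  have hM₂0 : 0 ≤ M₂ := (norm_nonneg _).trans (hM₂ w (hWK0 hw))
  have hB0 : 0 ≤ B := (norm_nonneg _).trans (hB w (hWK0 hw))
  -- The `o(M)` error of the determinant gets half of `η`; the terms quadratic in `h`, collected in
  -- `Q`, get the other half.
  obtain ⟨η', hη', hηlt⟩ : ∃ η' > 0, η' * (C + B) * M₀ ≤ η / 2 := by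
    refine ⟨η / 2 / ((C + B) * M₀ + 1), by positivity, ?_⟩
    rw [mul_assoc, div_mul_eq_mul_div, div_le_iff₀ (by positivity)]
    nlinarith
  obtain ⟨δ, hδ, hdet⟩ := Metric.eventually_nhds_iff.1
    ((ContinuousLinearMap.det_one_add_isLittleO (n := n)).def hη')
  set Q : ℝ := n * C * M₀ + (1 + n * B) * M₂ + n * B * M₁ with hQ
  have hQ0 : 0 ≤ Q := by positivity
  have hsmall : ∀ {c : ℝ}, 0 < c → ∀ a : ℝ, ∀ᶠ h in nhds (0 : ℝ), a * |h| < c := fun {c} hc a => by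
    have : Filter.Tendsto (fun h : ℝ => a * |h|) (nhds 0) (nhds 0) := by
      have : Continuous fun h : ℝ => a * |h| := by fun_prop
      simpa using this.tendsto 0
    exact this.eventually_lt_const hc
  filter_upwards [hsmall one_pos 1, hsmall hδ (C + B),
    hsmall one_pos (n * (C + B) + η' * (C + B)),
    hsmall (half_pos hη) Q] with h h1 hhδ hpos hhQ u hu hdiff
  have hh : |h| ≤ 1 := by linarith
  have huK := hWK0 hu
  have huD := hKD huK
  have hfd : DifferentiableAt ℝ f u :=
    (hf.differentiableOn (by simp)).differentiableAt (hD.mem_nhds huD)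
  have hgd : DifferentiableAt ℝ g u :=
    (hg.differentiableOn (by simp)).differentiableAt (hD.mem_nhds huD)
  set A := fderiv ℝ f u
  set P := fderiv ℝ (fun v => φ v h) u
  have hA : ‖A‖ ≤ B := hB u huK
  -- A derivative is bounded by a local Lipschitz constant; this replaces the variational equation
  -- for `Dφ_h`.
  have hP : ‖(P - 1) - h • A‖ ≤ C * |h| ^ 2 := by
    have := HasFDerivAt.le_of_lipschitzOn
      (f := fun v => φ v h - v - h • f v) (f' := P - 1 - h • A)
      ((hdiff.hasFDerivAt.fun_sub (hasFDerivAt_id u)).fun_sub (hfd.hasFDerivAt.const_smul h))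
      (hW.mem_nhds hu) (hC h hh)
    simpa using this
  have hh2 : |h| ^ 2 ≤ |h| := by nlinarith [abs_nonneg h]
  have hPn : ‖P - 1‖ ≤ (C + B) * |h| := by
    calc ‖P - 1‖ = ‖((P - 1) - h • A) + h • A‖ := by simp
      _ ≤ ‖(P - 1) - h • A‖ + ‖h • A‖ := norm_add_le _ _
      _ ≤ C * |h| ^ 2 + |h| * B := by rw [norm_smul, Real.norm_eq_abs]; gcongr
      _ ≤ C * |h| + |h| * B := by gcongr
      _ = _ := by ring
  have hd := hdet (y := P - 1) (by rw [dist_zero_right]; linarith)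
  rw [add_sub_cancel, Real.norm_eq_abs] at hd
  set τP := ∑ i, (P - 1) (Pi.single i 1) i
  set τA := ∑ i, A (Pi.single i 1) i with hτA_def
  have hτA : |τA| ≤ n * B := (abs_sum_apply_single_le A).trans (by gcongr)
  have hτ : |τP - h * τA| ≤ n * (C * |h| ^ 2) := by
    refine le_trans (le_of_eq ?_) ((abs_sum_apply_single_le ((P - 1) - h • A)).trans (by gcongr))
    simp [τP, τA, Finset.mul_sum, Finset.sum_sub_distrib]
  have hτP : |τP| ≤ n * ((C + B) * |h|) := (abs_sum_apply_single_le _).trans (by gcongr)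
  have hd' : |P.det - 1 - τP| ≤ η' * ((C + B) * |h|) := hd.trans (by gcongr)
  have hdetpos : 0 < P.det := by
    have := abs_le.1 hd'
    have := abs_le.1 hτP
    nlinarith
  have hd'' : |P.det - 1 - h * τA| ≤ η' * ((C + B) * |h|) + n * (C * |h| ^ 2) := by
    calc |P.det - 1 - h * τA| = |(P.det - 1 - τP) + (τP - h * τA)| := by ring_nf
      _ ≤ _ := (abs_add_le _ _).trans (add_le_add hd' hτ)
  have hgT : |g (φ u h) - g u - h * fderiv ℝ g u (f u)| ≤ M₂ * h ^ 2 := by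
    have hm : ∀ s, |s| ≤ |h| → φ u s ∈ K := fun s hs => hWK u hu s (hs.trans hh)
    have := norm_taylor_two_le (h := h) (γ := fun s => g (φ u s)) (B := M₂)
      (fun s hs => hφ.hasDerivAt_comp hD hg (hWU hu) (hKD (hm s hs)))
      (fun s hs => hφ.hasDerivAt_comp hD hgf (hWU hu) (hKD (hm s hs)))
      (fun s hs => hM₂ _ (hm s hs))
    simpa [hφ.map_zero u (hWU hu)] using this
  rw [divergence_smul hgd hfd, abs_of_pos hdetpos, ← hτA_def]
  set Lg := fderiv ℝ g u (f u)
  have hLg : |Lg| ≤ M₁ := hM₁ u huK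
  have hgφ : |g (φ u h)| ≤ M₀ := hM₀ _ (hWK u hu h hh)
  have hkey : P.det * g (φ u h) - g u - h * (Lg + g u * τA) =
      (P.det - 1 - h * τA) * g (φ u h) + (1 + h * τA) * (g (φ u h) - g u - h * Lg)
        + h ^ 2 * τA * Lg := by ring
  have h1τ : |1 + h * τA| ≤ 1 + n * B := by
    refine (abs_add_le _ _).trans ?_
    rw [abs_one, abs_mul]
    have : |h| * |τA| ≤ 1 * (n * B) := by gcongr
    linarith
  rw [hkey, Real.norm_eq_abs]
  calc _ ≤ |(P.det - 1 - h * τA) * g (φ u h)|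
        + |(1 + h * τA) * (g (φ u h) - g u - h * Lg)| + |h ^ 2 * τA * Lg| := abs_add_three _ _ _
    _ ≤ (η' * ((C + B) * |h|) + n * (C * |h| ^ 2)) * M₀ + (1 + n * B) * (M₂ * |h| ^ 2)
        + |h| ^ 2 * (n * B) * M₁ := by
      rw [abs_mul, abs_mul, abs_mul, abs_mul, abs_pow]
      rw [← sq_abs] at hgT
      gcongr
    _ = (η' * (C + B) * M₀) * |h| + Q * |h| * |h| := by rw [hQ]; ring
    _ ≤ (η / 2) * |h| + (η / 2) * |h| := by gcongr
    _ = η * |h| := by ring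

end IsFlowOn

/-! ### Smoothness of `Γ_k` and the transport theorem -/

theorem ContDiffOn.divergence {n : ℕ} {F : (Fin n → ℝ) → (Fin n → ℝ)} {D : Set (Fin n → ℝ)}
    (hD : IsOpen D) (hF : ContDiffOn ℝ ∞ F D) : ContDiffOn ℝ ∞ (divergence F) D :=
  ContDiffOn.sum fun i _ =>
    ((contDiffOn_pi.1 hF i).fderiv_of_isOpen hD (by simp)).clm_apply contDiffOn_const

theorem ContDiffOn.gam {n : ℕ} {f : (Fin n → ℝ) → (Fin n → ℝ)} {D : Set (Fin n → ℝ)}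
    (hD : IsOpen D) (hf : ContDiffOn ℝ ∞ f D) : ∀ k, ContDiffOn ℝ ∞ (Gam f k) D
  | 0 => contDiffOn_const
  | k + 1 => ContDiffOn.divergence hD ((ContDiffOn.gam hD hf k).smul hf)

/-- Lebesgue measure here is `n`-dimensional Hausdorff measure, which a `C`-Lipschitz map enlarges
by at most `C ^ n`. -/
theorem LipschitzOnWith.volume_image_eq_zero {n : ℕ} {ψ : (Fin n → ℝ) → (Fin n → ℝ)}
    {C : NNReal} {N : Set (Fin n → ℝ)} (hψ : LipschitzOnWith C ψ N) (hN : volume N = 0) :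
    volume (ψ '' N) = 0 := by
  rw [← hausdorffMeasure_pi_real] at hN ⊢
  have := hψ.hausdorffMeasure_image_le (d := Fintype.card (Fin n)) (by positivity)
  rw [hN, mul_zero] at this
  exact nonpos_iff_eq_zero.1 this

namespace IsFlowOn

variable {n : ℕ} {f : (Fin n → ℝ) → (Fin n → ℝ)} {φ : (Fin n → ℝ) → ℝ → (Fin n → ℝ)}
  {U D K W : Set (Fin n → ℝ)}

/-- Reynolds transport theorem for a control mass transported by the flow. -/
theorem hasDerivAt_setIntegral_image (hφ : IsFlowOn f φ U) (hD : IsOpen D)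
    (hf : ContDiffOn ℝ ∞ f D) (hK : IsCompact K) (hKc : Convex ℝ K) (hKD : K ⊆ D)
    (hW : IsOpen W) (hWU : W ⊆ U) (hWK : ∀ u ∈ W, ∀ h, |h| ≤ 1 → φ u h ∈ K)
    (hinj : ∀ h, Set.InjOn (fun u => φ u h) U)
    {g : (Fin n → ℝ) → ℝ} (hg : ContDiffOn ℝ ∞ g D) {A : Set (Fin n → ℝ)}
    (hA : MeasurableSet A) (hAW : A ⊆ W) :
    HasDerivAt (fun h => ∫ u in (fun u => φ u h) '' A, g u)
      (∫ u in A, divergence (fun v => g v • f v) u) 0 := by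
  have hWK0 : W ⊆ K := fun u hu => by simpa [hφ.map_zero u (hWU hu)] using hWK u hu 0 (by simp)
  have hAK := hAW.trans hWK0
  have hgK : IntegrableOn g K := (hg.continuousOn.mono hKD).integrableOn_compact hK
  have hdK : IntegrableOn (divergence fun v => g v • f v) K :=
    ((ContDiffOn.divergence hD (hg.smul hf)).continuousOn.mono hKD).integrableOn_compact hK
  obtain ⟨C, hC⟩ := hφ.exists_lipschitzOnWith hf hK hKc hKD hWU hWK
  have hAfin : volume A < ⊤ := (measure_mono hAK).trans_lt hK.measure_lt_top
  rw [hasDerivAt_iff_isLittleO_nhds_zero, Asymptotics.isLittleO_iff]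
  intro c hc
  have hη : 0 < c / (volume.real A + 1) := by positivity
  filter_upwards [hφ.eventually_abs_det_fderiv_mul_sub_le hD hf hK hKc hKD hW hWU hWK hg hη,
    Metric.ball_mem_nhds (0 : ℝ) one_pos] with h hbound hh
  replace hh : |h| ≤ 1 := by simpa using (Metric.mem_ball.1 hh).le
  set ψ : (Fin n → ℝ) → (Fin n → ℝ) := fun u => φ u h
  have h0 : (fun u => φ u 0) '' A = A := by
    conv_rhs => rw [← Set.image_id A]
    exact Set.image_congr fun u hu => hφ.map_zero u (hWU (hAW hu))
  -- By Rademacher, `A \ S` is null, and so is its Lipschitz image; the change of variables is made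
  -- on `A ∩ S`.
  set S := {u | DifferentiableAt ℝ ψ u}
  have hS : MeasurableSet S := measurableSet_of_differentiableAt ℝ ψ
  have hAS : MeasurableSet (A ∩ S) := hA.inter hS
  have hnull : volume (A \ S) = 0 := by
    rw [measure_eq_zero_iff_ae_notMem]
    filter_upwards [(hC h hh).ae_differentiableWithinAt_of_mem (μ := volume)] with u hu hmem
    exact hmem.2 ((hu (hAW hmem.1)).differentiableAt (hW.mem_nhds (hAW hmem.1)))
  have hAae : (A ∩ S : Set _) =ᵐ[volume] A := by
    rw [← Set.sdiff_sdiff_right_self]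
    exact sdiff_null_ae_eq_self hnull
  have himage : ψ '' A =ᵐ[volume] ψ '' (A ∩ S) := by
    rw [← Set.inter_union_sdiff A S, Set.image_union]
    simp only [Set.inter_union_sdiff]
    exact union_ae_eq_left_of_ae_eq_empty (ae_eq_empty.2
      (((hC h hh).mono (Set.sdiff_subset.trans hAW)).volume_image_eq_zero hnull))
  have hder : ∀ u ∈ A ∩ S, HasFDerivWithinAt ψ (fderiv ℝ ψ u) (A ∩ S) u :=
    fun u hu => (DifferentiableAt.hasFDerivAt hu.2).hasFDerivWithinAt
  have hinjA : Set.InjOn ψ (A ∩ S) := (hinj h).mono (Set.inter_subset_left.trans (hAW.trans hWU))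
  have hi1 : IntegrableOn (fun u => |(fderiv ℝ ψ u).det| • g (ψ u)) (A ∩ S) :=
    (integrableOn_image_iff_integrableOn_abs_det_fderiv_smul volume hAS hder hinjA g).1
      (hgK.mono_set (by rintro _ ⟨u, hu, rfl⟩; exact hWK u (hAW hu.1) h hh))
  have hi2 : IntegrableOn g (A ∩ S) := hgK.mono_set (Set.inter_subset_left.trans hAK)
  have hi3 : IntegrableOn (divergence fun v => g v • f v) (A ∩ S) :=
    hdK.mono_set (Set.inter_subset_left.trans hAK)
  have hi12 : IntegrableOn (fun u => |(fderiv ℝ ψ u).det| • g (ψ u) - g u) (A ∩ S) := hi1.sub hi2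
  simp only [zero_add]
  rw [h0, setIntegral_congr_set himage, ← setIntegral_congr_set hAae,
    ← setIntegral_congr_set (f := divergence _) hAae,
    integral_image_eq_integral_abs_det_fderiv_smul volume hAS hder hinjA, smul_eq_mul,
    ← integral_const_mul, ← integral_sub hi1 hi2, ← integral_sub hi12 (hi3.const_mul h)]
  refine (norm_setIntegral_le_of_norm_le_const
    ((measure_mono Set.inter_subset_left).trans_lt hAfin)
    (fun u hu => hbound u (hAW hu.1) hu.2)).trans ?_
  have hle : volume.real (A ∩ S) ≤ volume.real A + 1 :=
    (measureReal_mono Set.inter_subset_left hAfin.ne).trans (by simp)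
  rw [Real.norm_eq_abs]
  calc c / (volume.real A + 1) * |h| * volume.real (A ∩ S)
      ≤ c / (volume.real A + 1) * |h| * (volume.real A + 1) := by gcongr
    _ = c * |h| := by field_simp

end IsFlowOn

/-! ### Cubes and control masses -/

theorem openCube_eq_pi (n : ℕ) : openCube n = Set.univ.pi fun _ => Set.Ioo 0 1 := by
  ext u; simp only [openCube, Set.mem_univ_pi, Set.mem_Ioo, Set.mem_ofPred_eq]

theorem isOpen_openCube (n : ℕ) : IsOpen (openCube n) :=
  openCube_eq_pi n ▸ isOpen_set_pi Set.finite_univ fun _ _ => isOpen_Ioo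

theorem convex_openCube (n : ℕ) : Convex ℝ (openCube n) :=
  openCube_eq_pi n ▸ convex_pi fun _ _ => convex_Ioo 0 1

theorem closedCube_eq_pi (n : ℕ) : closedCube n = Set.univ.pi fun _ => Set.Icc 0 1 := by
  ext u; simp only [closedCube, Set.mem_univ_pi, Set.mem_Icc, Set.mem_ofPred_eq]

theorem isCompact_closedCube (n : ℕ) : IsCompact (closedCube n) :=
  closedCube_eq_pi n ▸ isCompact_univ_pi fun _ => isCompact_Icc

theorem convex_closedCube (n : ℕ) : Convex ℝ (closedCube n) :=
  closedCube_eq_pi n ▸ convex_pi fun _ _ => convex_Icc 0 1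

theorem openCube_subset_closedCube (n : ℕ) : openCube n ⊆ closedCube n :=
  fun _ hu i => ⟨(hu i).1.le, (hu i).2.le⟩

theorem IsHyperrectangle.measurableSet {n : ℕ} {R : Set (Fin n → ℝ)} (hR : IsHyperrectangle R) :
    MeasurableSet R := by
  obtain ⟨I, hI, rfl⟩ := hR
  exact MeasurableSet.univ_pi fun i => (hI i).measurableSet

section ControlMass

variable {n : ℕ} {f : (Fin n → ℝ) → (Fin n → ℝ)} {φ : (Fin n → ℝ) → ℝ → (Fin n → ℝ)}
  {R : Set (Fin n → ℝ)} {τ : ℝ}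

theorem controlMass_add (hφ : IsFlowOn f φ (openCube n)) (hf : ContDiffOn ℝ 1 f (openCube n))
    (t h : ℝ) : controlMass φ R τ (t + h) = (fun u => φ u h) '' controlMass φ R τ t := by
  have hU := isOpen_openCube n
  have hUc := convex_openCube n
  ext u
  constructor
  · rintro ⟨hu, huR⟩
    refine ⟨φ u (-h), ⟨hφ.mapsTo u hu _, ?_⟩, hφ.map_map_neg hU hUc hf hu h⟩
    rw [← hφ.map_add hU hUc hf hu]
    convert huR using 2
    ring
  · rintro ⟨v, ⟨hv, hvR⟩, rfl⟩
    refine ⟨hφ.mapsTo v hv h, ?_⟩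
    rw [← hφ.map_add hU hUc hf hv]
    convert hvR using 2
    ring

theorem measurableSet_controlMass (hφ : IsFlowOn f φ (openCube n))
    (hf : ContDiffOn ℝ 1 f (openCube n)) (hR : MeasurableSet R) (t : ℝ) :
    MeasurableSet (controlMass φ R τ t) := by
  have hU := isOpen_openCube n
  have hc := hφ.continuousOn hU (convex_openCube n) hf (τ - t)
  have : controlMass φ R τ t =
      Subtype.val '' ((openCube n).domRestrict (fun u => φ u (τ - t)) ⁻¹' R) := by
    ext u; simp [controlMass, Set.domRestrict, and_comm]
  rw [this]
  exact hU.measurableSet.subtype_image (hc.domRestrict.measurable hR)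

/-- If `closure R` lies in the open cube, flowing it for times up to `|t - τ|` stays in a compact
set containing `Ω(t)`; `W` is a small thickening of that set, and `K` catches its trajectories for
one more unit of time. Otherwise `W` and `K` are the open and closed cubes. -/
theorem exists_nhds_controlMass (hφ : IsFlowOn f φ (openCube n))
    (hf : AnalyticOnNhd ℝ f (openCube n))
    (hreg : closure R ⊆ openCube n ∨ AnalyticOnNhd ℝ f (closedCube n)) (t : ℝ) :
    ∃ W K, IsOpen W ∧ controlMass φ R τ t ⊆ W ∧ W ⊆ openCube n ∧ IsCompact K ∧ Convex ℝ K ∧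
      K ⊆ {x | AnalyticAt ℝ f x} ∧ ∀ u ∈ W, ∀ h, |h| ≤ 1 → φ u h ∈ K := by
  have hU := isOpen_openCube n
  have hUc := convex_openCube n
  rcases hreg with hcl | hcl
  · have hf1 : ContDiffOn ℝ 1 f (openCube n) := fun u hu => (hf u hu).contDiffAt.contDiffWithinAt
    have hRc : IsCompact (closure R) := by
      refine ((isCompact_closedCube n).of_isClosed_subset isClosed_closure ?_)
      exact hcl.trans (openCube_subset_closedCube n)
    obtain ⟨K₁, hK₁, -, hK₁U, hmem₁⟩ := hφ.exists_isCompact hU hUc hf1 hRc hcl |t - τ|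
    obtain ⟨δ, hδ, hδU⟩ := hK₁.exists_cthickening_subset_open hU hK₁U
    obtain ⟨K, hK, hKc, hKU, hmem⟩ := hφ.exists_isCompact hU hUc hf1 hK₁.cthickening hδU 1
    refine ⟨Metric.thickening δ K₁, K, Metric.isOpen_thickening, ?_,
      (Metric.thickening_subset_cthickening δ K₁).trans hδU, hK, hKc, fun u hu => hf u (hKU hu),
      fun u hu => hmem u (Metric.thickening_subset_cthickening δ K₁ hu)⟩
    rintro u ⟨hu, huR⟩
    refine Metric.self_subset_thickening hδ K₁ ?_
    have := hmem₁ _ (subset_closure huR) (t - τ) le_rfl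
    rwa [← hφ.map_add hU hUc hf1 hu, show τ - t + (t - τ) = 0 by ring, hφ.map_zero u hu] at this
  · exact ⟨openCube n, closedCube n, hU, fun u hu => hu.1, subset_rfl, isCompact_closedCube n,
      convex_closedCube n, hcl, fun u hu h _ => openCube_subset_closedCube n (hφ.mapsTo u hu h)⟩

end ControlMass

/-! ### Iterating the transport theorem -/

theorem lemma1 (n : ℕ) (f : (Fin n → ℝ) → (Fin n → ℝ))
    (φ : (Fin n → ℝ) → ℝ → (Fin n → ℝ)) (R : Set (Fin n → ℝ)) (τ : ℝ)
    (hf : AnalyticOnNhd ℝ f (openCube n))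
    (hφ : IsFlowOn f φ (openCube n))
    (hR : IsHyperrectangle R) (hRU : R ⊆ openCube n)
    (hreg : closure R ⊆ openCube n ∨ AnalyticOnNhd ℝ f (closedCube n)) :
    ContDiff ℝ ∞ (volumeFunction φ R τ) ∧
      ∀ (k : ℕ) (t : ℝ),
        IntegrableOn (Gam f k) (controlMass φ R τ t) volume ∧
          iteratedDeriv k (volumeFunction φ R τ) t =
            ∫ u in controlMass φ R τ t, Gam f k u := by
  have hf1 : ContDiffOn ℝ 1 f (openCube n) := fun u hu => (hf u hu).contDiffAt.contDiffWithinAt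
  have hD : IsOpen {x | AnalyticAt ℝ f x} := isOpen_analyticAt ℝ f
  have hfD : ContDiffOn ℝ ∞ f {x | AnalyticAt ℝ f x} :=
    fun u hu => AnalyticAt.contDiffAt hu |>.contDiffWithinAt
  have hGD := ContDiffOn.gam hD hfD
  -- The transport theorem at `h = 0` with `g = Γ_k` and `A = Ω(t)`, moved to time `t` by
  -- `controlMass_add`.
  have hder : ∀ k t, HasDerivAt (fun t => ∫ u in controlMass φ R τ t, Gam f k u)
      (∫ u in controlMass φ R τ t, Gam f (k + 1) u) t := by
    intro k t
    obtain ⟨W, K, hW, hAW, hWU, hK, hKc, hKD, hWK⟩ :=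
      exists_nhds_controlMass (τ := τ) hφ hf hreg t
    have := hφ.hasDerivAt_setIntegral_image hD hfD hK hKc hKD hW hWU hWK
      (hφ.injOn (isOpen_openCube n) (convex_openCube n) hf1) (hGD k)
      (measurableSet_controlMass hφ hf1 hR.measurableSet t) hAW
    simp only [← controlMass_add hφ hf1] at this
    have h := HasDerivAt.comp_sub_const t t (by rwa [sub_self])
    simp only [add_sub_cancel] at h
    exact h
  have hiter : ∀ k, iteratedDeriv k (volumeFunction φ R τ) =
      fun t => ∫ u in controlMass φ R τ t, Gam f k u := by
    intro k
    induction k with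
    | zero => funext t; simp [volumeFunction, Gam]
    | succ k ih => funext t; rw [iteratedDeriv_succ, ih]; exact (hder k t).deriv
  refine ⟨contDiff_of_differentiable_iteratedDeriv fun k _ => ?_, fun k t => ⟨?_, by rw [hiter]⟩⟩
  · rw [hiter]
    exact fun t => (hder k t).differentiableAt
  · obtain ⟨W, K, -, hAW, hWU, hK, -, hKD, hWK⟩ :=
      exists_nhds_controlMass (τ := τ) hφ hf hreg t
    refine (((hGD k).continuousOn.mono hKD).integrableOn_compact hK).mono_set fun u hu => ?_
    simpa [hφ.map_zero u (hWU (hAW hu))] using hWK u (hAW hu) 0 (by simp)
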